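/- Let $\mathcal N$ be an $n$-input sorting network or permutation network. That is, $\mathcal N$ is a finite acyclic circuit with $n$ inputs and $n$ outputs made of $2$-input $2$-output gates, in which every network input and every gate result feeds exactly one gate operand or network output. It is a sorting network if, with comparators as gates (returning the minimum of the two operands on one result and the maximum on the other), it produces the same output sequence on all $n!$ permutations of $n$ distinct keys. It is a permutation network if, with switches as gates (each either passing or swapping its two operands), for each of the $n!$ permutations $\pi$ some setting of the switches routes every input $i$ to output $\pi(i)$. The DAG of $\mathcal N$ has one node for each of the $n$ inputs and two nodes for each gate, both having as predecessors the two nodes that produce the operands of the gate. Its output nodes are the nodes of out-degree $0$. Consider a BSP with $1\le p\le 2n/e$ processors. An execution is a finite sequence of supersteps; in each, every processor evaluates nodes and sends messages to other processors, each message carrying the value of at most one node and becoming visible at the beginning of the next superstep. A processor can evaluate a node only if the values of all predecessors of the node are in its local memory (evaluated there before, or received in an earlier superstep), and it can send only node values which it holds. The degree of a superstep is the maximum, over all processors, of the number of messages sent and of the number of messages received by the processor in it; the BSP communication complexity $H$ is the sum of the degrees of all supersteps. Let $\mathcal A$ be any such execution that evaluates the DAG of $\mathcal N$ without recomputation, i.e.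 every node (inputs included) is evaluated exactly once, and let $q$ be the maximum number of output nodes evaluated by a processor. Then \[ H_{\mathcal A}\ \ge\ \frac{n\log\bigl(n/(4eq^2)\bigr)}{4p\log(2n/p)}+\frac{\min\{q,\,n-q\}}{4}. \] Moreover, if $q\le n/2$, then \[ H_{\mathcal A}\ >\ \frac{n\log(n/e)}{8p\log(2n/p)}. \] -/

import Mathlib

/-! ### Networks of two-input two-output gates -/

/-- An acyclic circuit with `n` inputs and `n` outputs, whose gates (indexed by `K`) have two
operands and two results each, both indexed by `Bool`. Every consuming port (operand `b` of gate
`k`, written `Sum.inl (k, b)`, or network output `j`, written `Sum.inr j`) is wired to exactly one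
producing port (network input `i`, written `Sum.inl i`, or result `b` of gate `k`, written
`Sum.inr (k, b)`), and every producing port feeds exactly one consuming port. -/
structure GateNetwork (n : ℕ) (K : Type*) where
  wire : (K × Bool) ⊕ Fin n ≃ Fin n ⊕ (K × Bool)
  acyclic : ∀ k : K, ¬ Relation.TransGen
    (fun k₁ k₂ : K => ∃ b₁ b₂ : Bool, wire (Sum.inl (k₂, b₂)) = Sum.inr (k₁, b₁)) k k

namespace GateNetwork

variable {n : ℕ} {K : Type*}

/-- The producing port that feeds operand `b` of gate `k`. -/
def operand (N : GateNetwork n K) (k : K) (b : Bool) : Fin n ⊕ (K × Bool) :=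
  N.wire (Sum.inl (k, b))

/-- The producing port that feeds network output `j`. -/
def out (N : GateNetwork n K) (j : Fin n) : Fin n ⊕ (K × Bool) :=
  N.wire (Sum.inr j)

/-- `val` is the assignment of values to the producing ports when the network runs on the input
sequence `x` and gate `k` with operands `a₀, a₁` returns `op k b a₀ a₁` as its result `b`.
As the network is acyclic, there is exactly one such assignment. -/
def IsRun {α : Type*} (N : GateNetwork n K) (op : K → Bool → α → α → α) (x : Fin n → α)
    (val : Fin n ⊕ (K × Bool) → α) : Prop :=
  (∀ i, val (Sum.inl i) = x i) ∧
  ∀ k b, val (Sum.inr (k, b)) = op k b (val (N.operand k false)) (val (N.operand k true))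

/-- The gate `comparator`: result `false` is the minimum of the operands, result `true` the
maximum. -/
def comparator {α : Type*} [LinearOrder α] (b : Bool) (a₀ a₁ : α) : α :=
  if b then max a₀ a₁ else min a₀ a₁

/-- The gate `switch`: it passes its operands to its results if `swap = false`, and swaps them if
`swap = true`. -/
def switch {α : Type*} (swap : Bool) (b : Bool) (a₀ a₁ : α) : α :=
  if xor swap b then a₁ else a₀

/-- With comparators as gates, the network produces the same output sequence on all `n!`
permutations of `n` distinct input keys. -/
def IsSorting (N : GateNetwork n K) : Prop :=
  ∃ y : Fin n → Fin n, ∀ σ : Equiv.Perm (Fin n), ∃ val : Fin n ⊕ (K × Bool) → Fin n,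
    N.IsRun (fun _ => comparator) σ val ∧ ∀ j, val (N.out j) = y j

/-- With switches as gates, for every permutation `π` some setting of the switches routes every
input `i` to output `π i`. (Each item enters with its label `i`; every port carries exactly one
item, so the routes are disjoint.) -/
def IsPermuting (N : GateNetwork n K) : Prop :=
  ∀ π : Equiv.Perm (Fin n), ∃ (s : K → Bool) (val : Fin n ⊕ (K × Bool) → Fin n),
    N.IsRun (fun k => switch (s k)) id val ∧ ∀ i, val (N.out (π i)) = i

/-- The arcs of the computation DAG of the network. Its nodes are the `n` inputs and a pair of
nodes `(k, false)`, `(k, true)` for every gate `k`, both having the two nodes that produce the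
operands of `k` as predecessors. -/
def Arc (N : GateNetwork n K) (u v : Fin n ⊕ (K × Bool)) : Prop :=
  ∃ (k : K) (b b' : Bool), v = Sum.inr (k, b) ∧ u = N.operand k b'

end GateNetwork

/-! ### Evaluation of a computation DAG on a BSP -/

/-- A message from processor `src` to another processor `dst`. It carries the value of one node of
the DAG, or (`none`) data that are not the value of a node. -/
structure BSPMessage (p : ℕ) (V : Type*) where
  src : Fin p
  dst : Fin p
  ne : src ≠ dst
  content : Option V

/-- The schedule of an execution on a BSP with `p` processors, as far as nodes of a DAG with node
set `V` are concerned: the number of supersteps (numbered `0, …, steps - 1`), the sequence of nodes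
evaluated by processor `i` in superstep `j`, and the messages sent in superstep `j`. The entries
for `j ≥ steps` are meaningless and never used below. -/
structure BSPExecution (p : ℕ) (V : Type*) where
  steps : ℕ
  evals : ℕ → Fin p → List V
  msgs : ℕ → Multiset (BSPMessage p V)

namespace BSPExecution

variable {p : ℕ} {V : Type*}

/-- The nodes whose value is in the local memory of processor `i` at the beginning of superstep
`j`: those that `i` evaluated or received in an earlier superstep. -/
def known (A : BSPExecution p V) (j : ℕ) (i : Fin p) : Set V :=
  {v | ∃ j' < j, v ∈ A.evals j' i ∨ ∃ m ∈ A.msgs j', m.dst = i ∧ m.content = some v}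

/-- In superstep `j`, processor `i` evaluates node `v` as its `k`-th evaluation of this superstep.
The triples `(j, i, k)` with this property are the processor-time pairs of `v`. -/
def EvaluatesAt (A : BSPExecution p V) (v : V) (j : ℕ) (i : Fin p) (k : ℕ) : Prop :=
  j < A.steps ∧ (A.evals j i)[k]? = some v

/-- The execution evaluates the DAG with arc relation `Arc`: every node is evaluated; whenever a
node is evaluated, the values of all its predecessors are in the memory of the evaluating
processor; and a processor sends only node values which it holds. -/
structure Evaluates (A : BSPExecution p V) (Arc : V → V → Prop) : Prop where
  all : ∀ v, ∃ j i k, A.EvaluatesAt v j i k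
  operands : ∀ v j i k, A.EvaluatesAt v j i k →
    ∀ u, Arc u v → u ∈ A.known j i ∨ u ∈ (A.evals j i).take k
  sends : ∀ j < A.steps, ∀ m ∈ A.msgs j, ∀ v, m.content = some v →
    v ∈ A.known j m.src ∨ v ∈ A.evals j m.src

/-- No recomputation: every node is evaluated exactly once. -/
def WithoutRecomputation (A : BSPExecution p V) : Prop :=
  ∀ v, ∃! t : ℕ × Fin p × ℕ, A.EvaluatesAt v t.1 t.2.1 t.2.2

/-- The degree of superstep `j`: the maximum number of messages sent, or received, by any
processor. -/
def degree (A : BSPExecution p V) (j : ℕ) : ℕ :=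
  Finset.univ.sup fun i : Fin p =>
    max ((A.msgs j).countP fun m => m.src = i) ((A.msgs j).countP fun m => m.dst = i)

/-- The BSP communication complexity: the sum of the degrees of the supersteps. -/
def commComplexity (A : BSPExecution p V) : ℕ :=
  ∑ j ∈ Finset.range A.steps, A.degree j

/-- The output nodes (nodes of out-degree `0`) evaluated by processor `i`. -/
def outputsOf (A : BSPExecution p V) (Arc : V → V → Prop) (i : Fin p) : Set V :=
  {v | (∀ w, ¬ Arc v w) ∧ ∃ j k, A.EvaluatesAt v j i k}

/-- The maximum number of output nodes evaluated by a processor. -/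
noncomputable def maxOutputs (A : BSPExecution p V) (Arc : V → V → Prop) : ℕ :=
  Finset.univ.sup fun i : Fin p => (A.outputsOf Arc i).ncard

end BSPExecution

/-! Fix a permutation `π`. In the corresponding run of the switches every node carries the label of
exactly one input, so the value of input `i` is a token that messages must have transported from
the processor evaluating input `i` to the processor evaluating output `π i`. Two bounds follow.

* Counting: a message moves at most one token, so a superstep of degree `h` turns a given placement
  of the tokens into at most `∏ₐ (tₐ + 1) ^ h ≤ (2 * n / p) ^ (p * h)` others, where `tₐ` is the
  number of tokens at processor `a`. At most `q ^ n` permutations ask for the same final placement,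
  whence `n! ≤ q ^ n * (2 * n / p) ^ (p * H)`.
* Exchange: a processor with `q` outputs needs `q` foreign tokens for some permutation, or loses
  `n - q` of its own for another one.

The first claim is an average of the two bounds. If `q ^ 2 ≤ n / e`, counting alone gives the second
claim. Otherwise exchange alone gives it, as `n / p ≤ q` and `√(n / e) < q`. -/

section Counting

open Finset

variable {ι β : Type*}

theorem prod_le_sum_div_card_pow (s : Finset ι) {z : ι → ℝ} (hz : ∀ i ∈ s, 0 ≤ z i) :
    ∏ i ∈ s, z i ≤ ((∑ i ∈ s, z i) / #s) ^ #s := by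
  rcases s.eq_empty_or_nonempty with rfl | hs
  · simp
  have hprod : 0 ≤ ∏ i ∈ s, z i := prod_nonneg hz
  have hmean := Real.geom_mean_le_arith_mean s (fun _ => 1) z (by simp) (by simpa using hs) hz
  simp only [Real.rpow_one, sum_const, nsmul_eq_mul, mul_one, one_mul] at hmean
  calc ∏ i ∈ s, z i = ((∏ i ∈ s, z i) ^ (#s : ℝ)⁻¹) ^ #s :=
        (Real.rpow_inv_natCast_pow hprod hs.card_ne_zero).symm
    _ ≤ ((∑ i ∈ s, z i) / #s) ^ #s := by gcongr

theorem prod_card_fiber_add_one_le [Fintype ι] [Fintype β] [DecidableEq β]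
    (h : Fintype.card β ≤ Fintype.card ι) (g : ι → β) :
    ∏ b, ((#{i | g i = b} : ℝ) + 1) ≤
      (2 * Fintype.card ι / Fintype.card β : ℝ) ^ Fintype.card β := by
  have hsum : ∑ b, ((#{i | g i = b} : ℝ) + 1) = Fintype.card ι + Fintype.card β := by
    rw [sum_add_distrib, ← Nat.cast_sum, ← card_eq_sum_card_fiberwise (by simp)]
    simp
  refine (prod_le_sum_div_card_pow univ fun b _ => by positivity).trans ?_
  rw [hsum, card_univ, two_mul]
  gcongr

theorem card_perm_comp_eq_le [Fintype ι] [DecidableEq ι] [DecidableEq β] {f : ι → β} {q : ℕ}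
    (hf : ∀ b, #{i | f i = b} ≤ q) (g : ι → β) :
    #{π : Equiv.Perm ι | f ∘ π = g} ≤ q ^ Fintype.card ι :=
  calc #{π : Equiv.Perm ι | f ∘ π = g} ≤ #(Fintype.piFinset fun i => {j | f j = g i}) := by
        refine card_le_card_of_injOn (fun π => π) (fun π hπ => ?_) Equiv.coe_fn_injective.injOn
        simpa [funext_iff] using hπ
    _ ≤ q ^ Fintype.card ι := by
        rw [Fintype.card_piFinset]
        exact prod_le_pow_card _ _ _ fun i _ => hf (g i)

theorem exists_perm_min_card_le [Finite ι] [DecidableEq ι] (s t : Finset ι) :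
    ∃ π : Equiv.Perm ι, min #s #t ≤ #{i ∈ s | π i ∈ t} := by
  obtain ⟨s', hs, hs'⟩ := exists_subset_card_eq (min_le_left #s #t)
  obtain ⟨t', ht, ht'⟩ := exists_subset_card_eq (min_le_right #s #t)
  cases nonempty_fintype ι
  let e : {i // i ∈ s'} ≃ {i // i ∈ t'} := equivOfCardEq (hs'.trans ht'.symm)
  refine ⟨e.extendSubtype, hs'.ge.trans (card_le_card fun i hi => ?_)⟩
  exact mem_filter.2 ⟨hs hi, ht (e.extendSubtype_mem i hi)⟩

theorem card_le_countP_of_forall_exists (s : Finset ι) (t : Multiset β) (P : β → Prop)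
    [DecidablePred P] (label : β → Option ι)
    (h : ∀ i ∈ s, ∃ m ∈ t, P m ∧ label m = some i) : #s ≤ t.countP P := by
  have hle : s.val.map some ≤ (t.filter P).map label := by
    refine (Multiset.le_iff_subset (s.nodup.map (Option.some_injective ι))).2 fun x hx => ?_
    obtain ⟨i, hi, rfl⟩ := Multiset.mem_map.1 hx
    obtain ⟨m, hm, hP, hlabel⟩ := h i hi
    exact Multiset.mem_map.2 ⟨m, Multiset.mem_filter.2 ⟨hm, hP⟩, hlabel⟩
  simpa [Multiset.countP_eq_card_filter] using Multiset.card_le_card hle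

end Counting

namespace GateNetwork

variable {n : ℕ} {K α β : Type*} {N : GateNetwork n K}

theorem IsRun.sum_out [Finite K] {M : Type*} [AddCancelCommMonoid M]
    {op : K → Bool → α → α → α} {x : Fin n → α} {val : Fin n ⊕ (K × Bool) → α}
    (h : N.IsRun op x val) (f : α → M)
    (hop : ∀ k a₀ a₁, f (op k false a₀ a₁) + f (op k true a₀ a₁) = f a₀ + f a₁) :
    ∑ j, f (val (N.out j)) = ∑ i, f (x i) := by
  cases nonempty_fintype K
  have hgates : ∑ c, f (val (N.wire (Sum.inl c))) = ∑ c, f (val (Sum.inr c)) := by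
    simp only [Fintype.sum_prod_type, Fintype.sum_bool]
    refine Finset.sum_congr rfl fun k _ => ?_
    rw [h.2, h.2, add_comm, add_comm (f (op k true _ _)), hop]
    rfl
  have hwire := N.wire.sum_comp fun u => f (val u)
  simp only [Fintype.sum_sum_type, hgates, h.1] at hwire
  rw [add_comm] at hwire
  exact add_right_cancel hwire

theorem apply_comparator [LinearOrder α] (f : α → β) (b : Bool) (a₀ a₁ : α) :
    f (comparator b a₀ a₁) = switch (decide (a₁ < a₀)) b (f a₀) (f a₁) := by
  rcases lt_or_ge a₁ a₀ with h | h
  · cases b <;> simp [comparator, switch, h, h.le]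
  · cases b <;> simp [comparator, switch, h, not_lt.2 h]

theorem IsRun.exists_isRun_switch [LinearOrder α] {x : Fin n → α}
    {val : Fin n ⊕ (K × Bool) → α} (h : N.IsRun (fun _ => comparator) x val) (f : α → β) :
    ∃ s : K → Bool, N.IsRun (fun k => switch (s k)) (f ∘ x) (f ∘ val) :=
  ⟨fun k => decide (val (N.operand k true) < val (N.operand k false)),
    fun i => congrArg f (h.1 i),
    fun k b => (congrArg f (h.2 k b)).trans (apply_comparator f b _ _)⟩

theorem IsSorting.isPermuting [Finite K] (hN : N.IsSorting) : N.IsPermuting := by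
  obtain ⟨y, hy⟩ := hN
  have hsurj : Function.Surjective y := by
    intro c
    obtain ⟨val, hval, hout⟩ := hy 1
    have hsum := hval.sum_out (Pi.single c 1 : Fin n → ℕ) fun _ => fn_min_add_fn_max _
    by_contra! hc
    simp [hout, Pi.single_apply, hc] at hsum
  let ρ : Equiv.Perm (Fin n) := .ofBijective y (Finite.surjective_iff_bijective.1 hsurj)
  intro π
  obtain ⟨val, hval, hout⟩ := hy (π.trans ρ)
  obtain ⟨s, hs⟩ := hval.exists_isRun_switch (π.trans ρ).symm
  refine ⟨s, (π.trans ρ).symm ∘ val, ?_, fun i => ?_⟩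
  · rwa [Equiv.symm_comp_self] at hs
  · rw [Function.comp_apply, hout, Equiv.symm_apply_eq]
    rfl

theorem IsRun.exists_arc_eq {s : K → Bool} {x : Fin n → α} {val : Fin n ⊕ (K × Bool) → α}
    (h : N.IsRun (fun k => switch (s k)) x val) (k : K) (b : Bool) :
    ∃ u, N.Arc u (Sum.inr (k, b)) ∧ val u = val (Sum.inr (k, b)) := by
  refine ⟨N.operand k (xor (s k) b), ⟨k, b, _, rfl, rfl⟩, ?_⟩
  rw [h.2]
  dsimp only [switch]
  cases xor (s k) b <;> rfl

theorem out_injective (N : GateNetwork n K) : Function.Injective N.out :=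
  N.wire.injective.comp Sum.inr_injective

theorem forall_not_arc_iff_mem_range_out (N : GateNetwork n K) (u : Fin n ⊕ (K × Bool)) :
    (∀ w, ¬ N.Arc u w) ↔ u ∈ Set.range N.out := by
  constructor
  · intro h
    obtain ⟨⟨k, b⟩ | j, rfl⟩ := N.wire.surjective u
    · exact absurd ⟨k, false, b, rfl, rfl⟩ (h (Sum.inr (k, false)))
    · exact ⟨j, rfl⟩
  · rintro ⟨j, rfl⟩ w ⟨k, b, b', -, h⟩
    exact Sum.inr_ne_inl (N.wire.injective h)

end GateNetwork

namespace BSPExecution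

open Finset

variable {p : ℕ} {V ι : Type*} {A : BSPExecution p V} {val : V → ι} {i : ι} {a₀ : Fin p}

/-- Processor `a` evaluates node `v` at some time, possibly among other processors. -/
def EvaluatedBy (A : BSPExecution p V) (v : V) (a : Fin p) : Prop :=
  ∃ j k, A.EvaluatesAt v j a k

theorem WithoutRecomputation.exists_home (h : A.WithoutRecomputation) :
    ∃ home : V → Fin p, ∀ v a, A.EvaluatedBy v a → a = home v := by
  choose t _ ht using h
  exact ⟨fun v => (t v).2.1, fun v a ⟨j, k, hv⟩ => congrArg (·.2.1) (ht v (j, a, k) hv)⟩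

/-- The nodes are labelled with tokens by `val`. In superstep `j`, token `i` either stays at its
processor `a = b`, or travels from `a` to `b` with a message that carries a node labelled `i`. -/
def Moves (A : BSPExecution p V) (val : V → ι) (i : ι) (j : ℕ) (a b : Fin p) : Prop :=
  b = a ∨ ∃ m ∈ A.msgs j, m.src = a ∧ m.dst = b ∧ m.content.map val = some i

/-- Token `i`, which starts at processor `a₀`, can be at processor `a` at the beginning of
superstep `j`. -/
inductive Reaches (A : BSPExecution p V) (val : V → ι) (i : ι) (a₀ : Fin p) :
    ℕ → Fin p → Prop
  | start : Reaches A val i a₀ 0 a₀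
  | step {j : ℕ} {a b : Fin p} : Reaches A val i a₀ j a → A.Moves val i j a b →
      Reaches A val i a₀ (j + 1) b

theorem Reaches.mono {j j' : ℕ} {a : Fin p} (h : A.Reaches val i a₀ j a) (hj : j ≤ j') :
    A.Reaches val i a₀ j' a := by
  induction hj with
  | refl => exact h
  | step _ ih => exact ih.step (Or.inl rfl)

theorem Reaches.exists_trajectory {j : ℕ} {a : Fin p} (h : A.Reaches val i a₀ j a) :
    ∃ f : ℕ → Fin p, f 0 = a₀ ∧ f j = a ∧ ∀ j' < j, A.Moves val i j' (f j') (f (j' + 1)) := by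
  induction h with
  | start => exact ⟨fun _ => a₀, rfl, rfl, by simp⟩
  | @step j a b _ hmove ih =>
    obtain ⟨f, h0, hj, hf⟩ := ih
    refine ⟨fun t => if t ≤ j then f t else b, by simp [h0], by simp, fun j' hj' => ?_⟩
    rcases Nat.lt_succ_iff_lt_or_eq.1 hj' with hlt | rfl
    · simpa [hlt.le, Nat.succ_le_of_lt hlt] using hf j' hlt
    · simpa [hj] using hmove

theorem Evaluates.reaches_of_mem_known {Arc : V → V → Prop} (hA : A.Evaluates Arc) {u : V}
    {j : ℕ} (hj : j ≤ A.steps)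
    (hu : ∀ j' < j, ∀ a, u ∈ A.evals j' a → A.Reaches val (val u) a₀ j' a)
    {a : Fin p} (h : u ∈ A.known j a) : A.Reaches val (val u) a₀ j a := by
  induction j using Nat.strong_induction_on generalizing a with
  | _ j ih =>
    obtain ⟨j', hj', hev | ⟨m, hm, rfl, hc⟩⟩ := h
    · exact (hu j' hj' a hev).mono hj'.le
    · have hsrc : A.Reaches val (val u) a₀ j' m.src :=
        (hA.sends j' (hj'.trans_le hj) m hm u hc).elim
          (ih j' hj' (hj'.le.trans hj) fun t ht => hu t (ht.trans hj')) (hu j' hj' m.src)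
      exact (hsrc.step (Or.inr ⟨m, hm, rfl, rfl, by rw [hc]; rfl⟩)).mono hj'

theorem Evaluates.reaches_of_evaluatesAt {Arc : V → V → Prop} (hA : A.Evaluates Arc)
    {home : ι → Fin p}
    (hval : ∀ v, (∃ u, Arc u v ∧ val u = val v) ∨ ∀ a, A.EvaluatedBy v a → a = home (val v))
    {v : V} {j : ℕ} {a : Fin p} {k : ℕ} (h : A.EvaluatesAt v j a k) :
    A.Reaches val (val v) (home (val v)) j a := by
  induction j using Nat.strong_induction_on generalizing v a k with
  | _ j ihj =>
  induction k using Nat.strong_induction_on generalizing v with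
  | _ k ihk =>
    obtain ⟨u, huv, hu⟩ | hhome := hval v
    · rw [← hu]
      rcases hA.operands v j a k h u huv with hknown | hearlier
      · refine hA.reaches_of_mem_known h.1.le (fun j' hj' b hb => ?_) hknown
        obtain ⟨k', hk'⟩ := List.mem_iff_getElem?.1 hb
        exact ihj j' hj' ⟨hj'.trans h.1, hk'⟩
      · obtain ⟨k', hk', hget⟩ := List.mem_take_iff_getElem.1 hearlier
        exact ihk k' (by omega) ⟨h.1, List.getElem?_eq_some_iff.2 ⟨by omega, hget⟩⟩
    · rw [← hhome a ⟨j, k, h⟩]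
      exact Reaches.start.mono (Nat.zero_le j)

/-- All tokens move simultaneously in superstep `j`, from the placement `g` to the placement `g'`,
for a suitable labelling of the nodes with tokens. -/
def Step (A : BSPExecution p V) (j : ℕ) (g g' : ι → Fin p) : Prop :=
  ∃ val : V → ι, ∀ i, A.Moves val i j (g i) (g' i)

/-- The communication of the first `j` supersteps can transport the tokens from the placement `g₀`
to the placement `g`. -/
inductive Routes (A : BSPExecution p V) (g₀ : ι → Fin p) : ℕ → (ι → Fin p) → Prop
  | start : Routes A g₀ 0 g₀
  | step {j : ℕ} {g g' : ι → Fin p} : Routes A g₀ j g → A.Step j g g' → Routes A g₀ (j + 1) g'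

theorem Evaluates.routes {Arc : V → V → Prop} (hA : A.Evaluates Arc) {home dest : ι → Fin p}
    (hval : ∀ v, (∃ u, Arc u v ∧ val u = val v) ∨ ∀ a, A.EvaluatedBy v a → a = home (val v))
    (hdest : ∀ i, ∃ v, val v = i ∧ A.EvaluatedBy v (dest i)) :
    A.Routes home A.steps dest := by
  have htraj (i : ι) : ∃ f : ℕ → Fin p, f 0 = home i ∧ f A.steps = dest i ∧
      ∀ j < A.steps, A.Moves val i j (f j) (f (j + 1)) := by
    obtain ⟨v, rfl, j, k, h⟩ := hdest i
    exact ((hA.reaches_of_evaluatesAt hval h).mono h.1.le).exists_trajectory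
  choose f h0 hsteps hf using htraj
  have hroutes : ∀ j ≤ A.steps, A.Routes home j fun i => f i j := by
    intro j
    induction j with
    | zero => exact fun _ => funext h0 ▸ Routes.start
    | succ j ih => exact fun hj => (ih (by omega)).step ⟨val, fun i => hf i j hj⟩
  exact funext hsteps ▸ hroutes A.steps le_rfl

theorem countP_src_le_degree (A : BSPExecution p V) (j : ℕ) (a : Fin p) :
    (A.msgs j).countP (fun m => m.src = a) ≤ A.degree j :=
  (le_max_left _ _).trans (le_sup (f := fun i : Fin p =>
    max ((A.msgs j).countP fun m => m.src = i) ((A.msgs j).countP fun m => m.dst = i))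
    (mem_univ a))

theorem countP_dst_le_degree (A : BSPExecution p V) (j : ℕ) (a : Fin p) :
    (A.msgs j).countP (fun m => m.dst = a) ≤ A.degree j :=
  (le_max_right _ _).trans (le_sup (f := fun i : Fin p =>
    max ((A.msgs j).countP fun m => m.src = i) ((A.msgs j).countP fun m => m.dst = i))
    (mem_univ a))

open Classical in
/-- The placement of the tokens after every message `m` has taken token `load m`, if there is one,
to the processor `m.dst`. Of several messages with the same token an arbitrary one counts. -/
noncomputable def deliver (M : Finset (BSPMessage p V)) (load : M → Option ι) (g : ι → Fin p)
    (i : ι) : Fin p :=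
  if h : ∃ m, load m = some i then h.choose.1.dst else g i

theorem deliver_eq {M : Finset (BSPMessage p V)} {load : M → Option ι} {g g' : ι → Fin p}
    (hload : ∀ m i, load m = some i → m.1.dst = g' i)
    (hstay : ∀ i, (∀ m, load m ≠ some i) → g' i = g i) : deliver M load g = g' := by
  funext i
  unfold deliver
  split_ifs with h
  · exact hload _ i h.choose_spec
  · push Not at h
    exact (hstay i h).symm

open Classical in
theorem Step.exists_deliver_eq {j : ℕ} {g g' : ι → Fin p} (h : A.Step j g g') :
    ∃ load : (A.msgs j).toFinset → Option ι, (∀ m i, load m = some i → g i = m.1.src) ∧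
      deliver (A.msgs j).toFinset load g = g' := by
  obtain ⟨val, hval⟩ := h
  let load (m : (A.msgs j).toFinset) : Option ι :=
    (m.1.content.map val).filter fun i => g i = m.1.src ∧ g' i = m.1.dst
  have hload (m : (A.msgs j).toFinset) (i : ι) : load m = some i ↔
      m.1.content.map val = some i ∧ g i = m.1.src ∧ g' i = m.1.dst := by
    simp [load, Option.filter_eq_some_iff]
  refine ⟨load, fun m i hi => ((hload m i).1 hi).2.1,
    deliver_eq (fun m i hi => ((hload m i).1 hi).2.2.symm) fun i hnone => ?_⟩
  obtain hstay | ⟨m, hm, hsrc, hdst, hi⟩ := hval i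
  · exact hstay
  · exact absurd ((hload ⟨m, Multiset.mem_toFinset.2 hm⟩ i).2 ⟨hi, hsrc.symm, hdst.symm⟩)
      (hnone _)

variable [Fintype ι]

theorem Step.card_entering_le {j : ℕ} {g g' : ι → Fin p} (h : A.Step j g g') (a : Fin p) :
    #{i | g i ≠ a ∧ g' i = a} ≤ A.degree j := by
  obtain ⟨val, hval⟩ := h
  refine (card_le_countP_of_forall_exists _ (A.msgs j) (fun m => m.dst = a) (·.content.map val)
    fun i hi => ?_).trans (A.countP_dst_le_degree j a)
  obtain ⟨hg, hg'⟩ := (mem_filter.1 hi).2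
  obtain hstay | ⟨m, hm, -, hdst, hi⟩ := hval i
  · exact absurd (hstay.symm.trans hg') hg
  · exact ⟨m, hm, hdst.trans hg', hi⟩

theorem Step.card_leaving_le {j : ℕ} {g g' : ι → Fin p} (h : A.Step j g g') (a : Fin p) :
    #{i | g i = a ∧ g' i ≠ a} ≤ A.degree j := by
  obtain ⟨val, hval⟩ := h
  refine (card_le_countP_of_forall_exists _ (A.msgs j) (fun m => m.src = a) (·.content.map val)
    fun i hi => ?_).trans (A.countP_src_le_degree j a)
  obtain ⟨hg, hg'⟩ := (mem_filter.1 hi).2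
  obtain hstay | ⟨m, hm, hsrc, -, hi⟩ := hval i
  · exact absurd (hstay.trans hg) hg'
  · exact ⟨m, hm, hsrc.trans hg, hi⟩

theorem Routes.card_entering_le {g₀ g : ι → Fin p} {J : ℕ} (h : A.Routes g₀ J g) (a : Fin p) :
    #{i | g₀ i ≠ a ∧ g i = a} ≤ ∑ j ∈ range J, A.degree j := by
  classical
  induction h with
  | start => simp
  | @step j g g' _ hstep ih =>
    calc #{i | g₀ i ≠ a ∧ g' i = a}
        ≤ #(({i | g₀ i ≠ a ∧ g i = a} : Finset ι) ∪ ({i | g i ≠ a ∧ g' i = a} : Finset ι)) :=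
          card_le_card fun i => by simp only [mem_union, mem_filter, mem_univ, true_and]; tauto
      _ ≤ ∑ j ∈ range (j + 1), A.degree j := by
          rw [sum_range_succ]
          exact (card_union_le _ _).trans (add_le_add ih (hstep.card_entering_le a))

theorem Routes.card_leaving_le {g₀ g : ι → Fin p} {J : ℕ} (h : A.Routes g₀ J g) (a : Fin p) :
    #{i | g₀ i = a ∧ g i ≠ a} ≤ ∑ j ∈ range J, A.degree j := by
  classical
  induction h with
  | start => simp
  | @step j g g' _ hstep ih =>
    calc #{i | g₀ i = a ∧ g' i ≠ a}
        ≤ #(({i | g₀ i = a ∧ g i ≠ a} : Finset ι) ∪ ({i | g i = a ∧ g' i ≠ a} : Finset ι)) :=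
          card_le_card fun i => by simp only [mem_union, mem_filter, mem_univ, true_and]; tauto
      _ ≤ ∑ j ∈ range (j + 1), A.degree j := by
          rw [sum_range_succ]
          exact (card_union_le _ _).trans (add_le_add ih (hstep.card_leaving_le a))

theorem min_card_fiber_le_commComplexity {home host : ι → Fin p}
    (h : ∀ π : Equiv.Perm ι, A.Routes home A.steps (host ∘ π)) (a : Fin p) :
    min #{i | host i = a} (Fintype.card ι - #{i | host i = a}) ≤ A.commComplexity := by
  classical
  set s : Finset ι := {i | home i = a} with hs
  set t : Finset ι := {i | host i = a} with ht
  have henter : min #sᶜ #t ≤ A.commComplexity := by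
    obtain ⟨π, hπ⟩ := exists_perm_min_card_le sᶜ t
    refine hπ.trans (le_trans (card_le_card fun i hi => ?_) ((h π).card_entering_le a))
    simpa [hs, ht] using hi
  have hleave : min #s #tᶜ ≤ A.commComplexity := by
    obtain ⟨π, hπ⟩ := exists_perm_min_card_le s tᶜ
    refine hπ.trans (le_trans (card_le_card fun i hi => ?_) ((h π).card_leaving_le a))
    simpa [hs, ht] using hi
  rw [card_compl] at henter hleave
  omega

open Classical in
theorem card_step_le_prod (A : BSPExecution p V) (j : ℕ) (g : ι → Fin p) :
    #{g' | A.Step j g g'} ≤ ∏ m ∈ (A.msgs j).toFinset, (#{i | g i = m.src} + 1) := by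
  let loads : Finset ((A.msgs j).toFinset → Option ι) :=
    Fintype.piFinset fun m => insertNone {i | g i = m.1.src}
  have hsub : ({g' | A.Step j g g'} : Finset (ι → Fin p)) ⊆
      loads.image fun load => deliver _ load g := fun g' hg' => by
    obtain ⟨load, hload, rfl⟩ := (mem_filter.1 hg').2.exists_deliver_eq
    refine mem_image_of_mem _ (Fintype.mem_piFinset.2 fun m => mem_insertNone.2 fun i hi => ?_)
    simpa using hload m i hi
  calc #{g' | A.Step j g g'} ≤ #loads := (card_le_card hsub).trans card_image_le
    _ = ∏ m ∈ (A.msgs j).toFinset, (#{i | g i = m.src} + 1) := by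
      simp only [loads, Fintype.card_piFinset, card_insertNone]
      exact prod_coe_sort (A.msgs j).toFinset fun m => #{i | g i = m.src} + 1

open Classical in
theorem card_step_le (A : BSPExecution p V) (hp : p ≤ Fintype.card ι) (j : ℕ) (g : ι → Fin p) :
    (#{g' | A.Step j g g'} : ℝ) ≤ (2 * Fintype.card ι / p : ℝ) ^ (p * A.degree j) := by
  have hprod : #{g' | A.Step j g g'} ≤ (∏ a, (#{i | g i = a} + 1)) ^ A.degree j := by
    refine (A.card_step_le_prod j g).trans ?_
    rw [← prod_fiberwise_of_maps_to' (t := univ) (g := BSPMessage.src) (fun _ _ => mem_univ _)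
      (fun a => #{i | g i = a} + 1), ← prod_pow]
    refine prod_le_prod' fun a _ => ?_
    rw [prod_const]
    refine Nat.pow_le_pow_right (Nat.succ_pos _) (le_trans ?_ (A.countP_src_le_degree j a))
    exact card_le_countP_of_forall_exists _ _ _ some fun m hm => ⟨m, by simpa using hm⟩
  calc (#{g' | A.Step j g g'} : ℝ) ≤ (∏ a, ((#{i | g i = a} : ℝ) + 1)) ^ A.degree j := by
        exact_mod_cast hprod
    _ ≤ (2 * Fintype.card ι / p : ℝ) ^ (p * A.degree j) := by
        rw [pow_mul]
        gcongr
        simpa using prod_card_fiber_add_one_le (by simpa using hp) g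

open Classical in
theorem card_routes_le (A : BSPExecution p V) (hp : p ≤ Fintype.card ι) (g₀ : ι → Fin p)
    (J : ℕ) :
    (#{g | A.Routes g₀ J g} : ℝ) ≤
      (2 * Fintype.card ι / p : ℝ) ^ (p * ∑ j ∈ range J, A.degree j) := by
  induction J with
  | zero =>
    have hsub : ({g | A.Routes g₀ 0 g} : Finset (ι → Fin p)) ⊆ {g₀} := fun g hg => by
      cases (mem_filter.1 hg).2
      exact mem_singleton_self g₀
    simpa using card_le_card hsub
  | succ J ih =>
    set W : Finset (ι → Fin p) := {g | A.Routes g₀ J g} with hW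
    have hsub : ({g' | A.Routes g₀ (J + 1) g'} : Finset (ι → Fin p)) ⊆
        W.biUnion fun g => {g' | A.Step J g g'} := fun g' hg' => by
      obtain _ | ⟨hroutes, hstep⟩ := (mem_filter.1 hg').2
      exact mem_biUnion.2 ⟨_, by simpa [hW] using hroutes, by simpa using hstep⟩
    calc (#{g' | A.Routes g₀ (J + 1) g'} : ℝ)
        ≤ ∑ g ∈ W, (#{g' | A.Step J g g'} : ℝ) := by
          exact_mod_cast (card_le_card hsub).trans card_biUnion_le
      _ ≤ #W * (2 * Fintype.card ι / p : ℝ) ^ (p * A.degree J) := by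
          rw [← nsmul_eq_mul]
          exact sum_le_card_nsmul _ _ _ fun g _ => A.card_step_le hp J g
      _ ≤ (2 * Fintype.card ι / p : ℝ) ^ (p * ∑ j ∈ range (J + 1), A.degree j) := by
          rw [sum_range_succ, mul_add, pow_add]
          gcongr

theorem factorial_card_le {home host : ι → Fin p} (hp : p ≤ Fintype.card ι)
    (h : ∀ π : Equiv.Perm ι, A.Routes home A.steps (host ∘ π)) {q : ℕ}
    (hq : ∀ a, #{i | host i = a} ≤ q) :
    ((Fintype.card ι).factorial : ℝ) ≤
      q ^ Fintype.card ι * (2 * Fintype.card ι / p : ℝ) ^ (p * A.commComplexity) := by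
  classical
  have hcard : (Fintype.card ι).factorial ≤
      q ^ Fintype.card ι * #{g | A.Routes home A.steps g} := by
    rw [← Fintype.card_perm, ← card_univ]
    exact card_le_mul_card_image_of_maps_to (f := fun π : Equiv.Perm ι => host ∘ π)
      (fun π _ => by simpa using h π) _ fun g _ => card_perm_comp_eq_le hq g
  calc ((Fintype.card ι).factorial : ℝ)
      ≤ q ^ Fintype.card ι * #{g | A.Routes home A.steps g} := by exact_mod_cast hcard
    _ ≤ q ^ Fintype.card ι * (2 * Fintype.card ι / p : ℝ) ^ (p * A.commComplexity) := by
        gcongr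
        exact A.card_routes_le hp home A.steps

end BSPExecution

namespace GateNetwork

open Finset

variable {n p : ℕ} {K : Type*} {N : GateNetwork n K} {A : BSPExecution p (Fin n ⊕ (K × Bool))}

theorem IsPermuting.routes (hN : N.IsPermuting) (hA : A.Evaluates N.Arc)
    {home host : Fin n → Fin p} (hhome : ∀ i a, A.EvaluatedBy (Sum.inl i) a → a = home i)
    (hhost : ∀ j, A.EvaluatedBy (N.out j) (host j)) (π : Equiv.Perm (Fin n)) :
    A.Routes home A.steps (host ∘ π) := by
  obtain ⟨s, val, hval, hout⟩ := hN π
  refine hA.routes (val := val) ?_ fun i => ⟨N.out (π i), hout i, hhost (π i)⟩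
  rintro (i | ⟨k, b⟩)
  · exact Or.inr fun a ha => by rw [hval.1, id, hhome i a ha]
  · exact Or.inl (hval.exists_arc_eq k b)

theorem ncard_outputsOf (N : GateNetwork n K) (A : BSPExecution p (Fin n ⊕ (K × Bool)))
    (a : Fin p) :
    (A.outputsOf N.Arc a).ncard = {j | A.EvaluatedBy (N.out j) a}.ncard := by
  rw [← Set.ncard_image_of_injective _ N.out_injective]
  congr 1
  ext u
  simp only [BSPExecution.outputsOf, N.forall_not_arc_iff_mem_range_out]
  constructor
  · rintro ⟨⟨j, rfl⟩, h⟩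
    exact ⟨j, h, rfl⟩
  · rintro ⟨j, h, rfl⟩
    exact ⟨⟨j, rfl⟩, h⟩

theorem exists_host (hp : 0 < p) (hA : A.Evaluates N.Arc) :
    ∃ host : Fin n → Fin p, (∀ j, A.EvaluatedBy (N.out j) (host j)) ∧
      (∀ b, #{j | host j = b} ≤ A.maxOutputs N.Arc) ∧
      ∃ a, #{j | host j = a} = A.maxOutputs N.Arc := by
  classical
  let outputs (b : Fin p) : Finset (Fin n) := {j | A.EvaluatedBy (N.out j) b}
  have hcard (b : Fin p) : (A.outputsOf N.Arc b).ncard = #(outputs b) := by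
    rw [N.ncard_outputsOf, ← Set.ncard_coe_finset]
    simp [outputs]
  obtain ⟨a, -, ha⟩ := exists_mem_eq_sup univ ⟨⟨0, hp⟩, mem_univ _⟩
    fun b => (A.outputsOf N.Arc b).ncard
  have hany (j : Fin n) : ∃ b, A.EvaluatedBy (N.out j) b :=
    let ⟨t, b, k, h⟩ := hA.all (N.out j)
    ⟨b, t, k, h⟩
  choose other hother using hany
  let host (j : Fin n) : Fin p := if A.EvaluatedBy (N.out j) a then a else other j
  have hhost (j : Fin n) : A.EvaluatedBy (N.out j) (host j) := by
    by_cases h : A.EvaluatedBy (N.out j) a <;> simp [host, h, hother]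
  have hsub (b : Fin p) : ({j | host j = b} : Finset (Fin n)) ⊆ outputs b := fun j hj => by
    simpa [outputs, (mem_filter.1 hj).2] using hhost j
  have hle (b : Fin p) : #{j | host j = b} ≤ A.maxOutputs N.Arc :=
    (card_le_card (hsub b)).trans
      ((hcard b).symm.trans_le (le_sup (f := fun b => (A.outputsOf N.Arc b).ncard) (mem_univ b)))
  refine ⟨host, hhost, hle, a, (hle a).antisymm ?_⟩
  rw [BSPExecution.maxOutputs, ha, hcard]
  exact card_le_card fun j hj => by
    have hj : A.EvaluatedBy (N.out j) a := by simpa [outputs] using hj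
    simp [host, hj]

end GateNetwork

section Estimates

open Real

theorem mul_log_le_of_factorial_le {n q M : ℕ} {c : ℝ} (hn : 0 < n) (hq : 0 < q) (hc : 0 < c)
    (h : (n.factorial : ℝ) ≤ q ^ n * c ^ M) : n * log (n / (exp 1 * q)) ≤ M * log c := by
  have hlog : log n.factorial ≤ n * log q + M * log c := by
    refine (log_le_log (by positivity) h).trans_eq ?_
    rw [log_mul (by positivity) (by positivity), log_pow, log_pow]
  have hfactorial : n * log n - n ≤ log n.factorial := by
    have hstirling := Stirling.le_log_factorial_stirling hn.ne'
    have hlog_n : 0 ≤ log n := log_natCast_nonneg n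
    have hlog_pi : 0 ≤ log (2 * π) := log_nonneg (by linarith [pi_gt_three])
    linarith
  rw [log_div (by positivity) (by positivity), log_mul (by positivity) (by positivity), log_exp]
  linarith

theorem exp_mul_le_mul_exp_half {x y : ℝ} (hx : 1 / 2 ≤ x) (hxy : 8 * x ≤ y) :
    exp x * y ≤ 16 * x * exp (y / 2) := by
  have hexp : exp x ≤ exp (y / 8) := exp_le_exp.2 (by linarith)
  have hy : y ≤ 16 * x * exp (3 * y / 8) := by
    nlinarith [add_one_le_exp (3 * y / 8)]
  calc exp x * y ≤ exp (y / 8) * (16 * x * exp (3 * y / 8)) := by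
        gcongr
        linarith
    _ = 16 * x * exp (y / 2) := by
        rw [mul_left_comm, ← exp_add]
        ring_nf

theorem half_lt_log_two_mul_div {n p : ℝ} (hp : 0 < p) (hpn : p ≤ n) :
    1 / 2 < log (2 * n / p) := by
  have htwo : 2 ≤ 2 * n / p := by
    rw [le_div_iff₀ hp]
    linarith
  linarith [log_two_gt_d9, log_le_log two_pos htwo]

theorem average_le_of_counting_of_exchange {n p q H : ℝ} (hp : 0 < p) (hpn : p ≤ n) (hq : 1 ≤ q)
    (hqn : q ≤ n) (hcount : n * log (n / (exp 1 * q)) ≤ p * H * log (2 * n / p))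
    (hexch : min q (n - q) ≤ H) :
    n * log (n / (4 * exp 1 * q ^ 2)) / (4 * p * log (2 * n / p)) + min q (n - q) / 4 ≤ H := by
  have hn : 0 < n := hp.trans_le hpn
  have hL : 0 < log (2 * n / p) := by linarith [half_lt_log_two_mul_div hp hpn]
  have hlog : log (n / (4 * exp 1 * q ^ 2)) ≤ log (n / (exp 1 * q)) := by
    gcongr
    · linarith [exp_pos 1]
    · nlinarith
  have hquarter : n * log (n / (4 * exp 1 * q ^ 2)) / (4 * p * log (2 * n / p)) ≤ H / 4 := by
    rw [div_le_iff₀ (by positivity)]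
    calc n * log (n / (4 * exp 1 * q ^ 2)) ≤ n * log (n / (exp 1 * q)) := by gcongr
      _ ≤ p * H * log (2 * n / p) := hcount
      _ = H / 4 * (4 * p * log (2 * n / p)) := by ring
  have hH : 0 ≤ H := (le_min (by linarith) (by linarith)).trans hexch
  linarith

theorem div_lt_of_counting_of_exchange {n p q H : ℝ} (hp : 0 < p) (hpn : p ≤ n) (hnq : n ≤ p * q)
    (hcount : n * log (n / (exp 1 * q)) ≤ p * H * log (2 * n / p)) (hexch : q ≤ H) :
    n * log (n / exp 1) / (8 * p * log (2 * n / p)) < H := by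
  have hn : 0 < n := hp.trans_le hpn
  have hq : 0 < q := pos_of_mul_pos_right (hn.trans_le hnq) hp.le
  have hH : 0 < H := hq.trans_le hexch
  have hL : 1 / 2 < log (2 * n / p) := half_lt_log_two_mul_div hp hpn
  have hexpL : exp (log (2 * n / p)) * p = 2 * n := by
    rw [exp_log (by positivity), div_mul_cancel₀ _ hp.ne']
  rw [← div_div, log_div (by positivity) hq.ne'] at hcount
  rw [div_lt_iff₀ (by positivity)]
  set L := log (2 * n / p)
  set l := log (n / exp 1)
  have hpHL : 0 < p * H * L := by positivity
  rcases le_or_gt (2 * log q) l with hql | hql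
  · nlinarith
  rcases lt_or_ge l (8 * L) with hlL | hlL
  · calc n * l < n * (8 * L) := by gcongr
      _ ≤ p * H * (8 * L) := by
        gcongr
        exact hnq.trans (by gcongr)
      _ = H * (8 * p * L) := by ring
  · have hexpq : exp (l / 2) < q := by
      rw [← lt_log_iff_exp_lt hq]
      linarith
    have : 2 * (n * l) < 2 * (H * (8 * p * L)) :=
      calc 2 * (n * l) = exp L * l * p := by linear_combination -l * hexpL
        _ ≤ 16 * L * exp (l / 2) * p :=
          mul_le_mul_of_nonneg_right (exp_mul_le_mul_exp_half hL.le hlL) hp.le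
        _ < 16 * L * H * p := by gcongr; exact hexpq.trans_le hexch
        _ = 2 * (H * (8 * p * L)) := by ring
    linarith

theorem le_of_cast_le_two_mul_div_exp_one {p n : ℕ} (h : (p : ℝ) ≤ 2 * n / exp 1) : p ≤ n := by
  have hdiv : (2 * n / exp 1 : ℝ) ≤ n := by
    rw [div_le_iff₀ (exp_pos 1)]
    nlinarith [exp_one_gt_d9, (Nat.cast_nonneg n : (0 : ℝ) ≤ n)]
  exact_mod_cast h.trans hdiv

end Estimates

theorem theorem4_general {n p : ℕ} {K : Type*} (N : GateNetwork n K) (hN : N.IsPermuting)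
    (hp : 1 ≤ p) (hpn : p ≤ n)
    (A : BSPExecution p (Fin n ⊕ (K × Bool))) (hA : A.Evaluates N.Arc)
    (home : Fin n → Fin p) (hhome : ∀ i a, A.EvaluatedBy (Sum.inl i) a → a = home i)
    (q : ℕ) (hq : q = A.maxOutputs N.Arc) :
    (n * Real.log (n / (4 * Real.exp 1 * q ^ 2)) / (4 * p * Real.log (2 * n / p))
        + min (q : ℝ) (n - q) / 4 ≤ (A.commComplexity : ℝ)) ∧
    ((q : ℝ) ≤ n / 2 →
      n * Real.log (n / Real.exp 1) / (8 * p * Real.log (2 * n / p))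
        < (A.commComplexity : ℝ)) := by
  obtain ⟨host, hhost, hle, a, ha⟩ := GateNetwork.exists_host hp hA
  rw [← hq] at hle ha
  have hroutes := hN.routes hA hhome hhost
  have hnq : n ≤ p * q := by
    simpa [mul_comm p] using Finset.card_le_mul_card_image_of_maps_to
      (s := Finset.univ) (t := Finset.univ) (fun j _ => Finset.mem_univ (host j)) q fun b _ => hle b
  have hqn : q ≤ n := by simpa [ha] using Finset.card_le_univ {j | host j = a}
  have hn : 0 < n := by omega
  have hq0 : 0 < q := pos_of_mul_pos_right (by omega : 0 < p * q) p.zero_le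
  have hcount : n * Real.log (n / (Real.exp 1 * q)) ≤
      p * A.commComplexity * Real.log (2 * n / p) := by
    have hfactorial := BSPExecution.factorial_card_le (by simpa using hpn) hroutes hle
    rw [Fintype.card_fin] at hfactorial
    exact_mod_cast mul_log_le_of_factorial_le hn hq0 (by positivity) hfactorial
  have hexch : min (q : ℝ) (n - q) ≤ A.commComplexity := by
    have hmin := BSPExecution.min_card_fiber_le_commComplexity hroutes a
    rw [ha, Fintype.card_fin] at hmin
    exact_mod_cast hmin
  have hp' : (0 : ℝ) < p := by exact_mod_cast hp
  have hpn' : (p : ℝ) ≤ n := by exact_mod_cast hpn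
  refine ⟨average_le_of_counting_of_exchange hp' hpn' (by exact_mod_cast hq0)
    (by exact_mod_cast hqn) hcount hexch, fun hq_half =>
    div_lt_of_counting_of_exchange hp' hpn' (by exact_mod_cast hnq) hcount ?_⟩
  rwa [min_eq_left (by linarith)] at hexch

theorem theorem4 {n p : ℕ} {K : Type*} [Fintype K] (N : GateNetwork n K)
    (hN : N.IsSorting ∨ N.IsPermuting)
    (hp : 1 ≤ p) (hpn : (p : ℝ) ≤ 2 * n / Real.exp 1)
    (A : BSPExecution p (Fin n ⊕ (K × Bool)))
    (hA : A.Evaluates N.Arc) (hrec : A.WithoutRecomputation)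
    (q : ℕ) (hq : q = A.maxOutputs N.Arc) :
    (n * Real.log (n / (4 * Real.exp 1 * q ^ 2)) / (4 * p * Real.log (2 * n / p))
        + min (q : ℝ) (n - q) / 4 ≤ (A.commComplexity : ℝ)) ∧
    ((q : ℝ) ≤ n / 2 →
      n * Real.log (n / Real.exp 1) / (8 * p * Real.log (2 * n / p))
        < (A.commComplexity : ℝ)) := by
  obtain ⟨home, hhome⟩ := hrec.exists_home
  exact theorem4_general N (hN.elim GateNetwork.IsSorting.isPermuting id) hp
    (le_of_cast_le_two_mul_div_exp_one hpn) A hA (home ∘ Sum.inl) (fun i => hhome _) q hq
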